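/- Let $n,m\ge 0$ be integers, $Q_0,\dots,Q_m$ real symmetric $n\times n$ matrices, $c_0,\dots,c_m\in\mathbb{R}^n$, $b\in\mathbb{R}^m$, $\ell\in\mathbb{R}^n_+$, $u\in\mathbb{R}^n$, and write $\langle A,B\rangle=\sum_{i,j}a_{ij}b_{ij}$. Assume that the quadratic program $$(P)\quad \min\ \langle Q_0,xx^T\rangle+c_0^Tx\quad\text{s.t.}\quad \langle Q_r,xx^T\rangle+c_r^Tx\le b_r\ (r=1,\dots,m),\quad \ell_i\le x_i\le u_i\ (i=1,\dots,n)$$ has a feasible point. For $x\in\mathbb{R}^n$, a symmetric $n\times n$ matrix $Y$ and $i\le j$, the McCormick functions are $$\begin{aligned} h^1_{ij}&=Y_{ij}-u_jx_i-\ell_ix_j+u_j\ell_i, & h^2_{ij}&=Y_{ij}-u_ix_j-\ell_jx_i+u_i\ell_j,\\ h^3_{ij}&=-Y_{ij}+u_jx_i+u_ix_j-u_iu_j, & h^4_{ij}&=-Y_{ij}+\ell_jx_i+\ell_ix_j-\ell_i\ell_j, \end{aligned}$$ and for $i<j<k$ the general triangle functions are $$\begin{aligned} h'^{1}_{ijk}&=(\ell_k-u_k)Y_{ij}+(\ell_j-u_j)Y_{ik}-u_iY_{jk}+u_iu_kx_j+(u_ju_k-\ell_j\ell_k)x_i+u_iu_jx_k-u_iu_ju_k,\\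 h'^{2}_{ijk}&=(\ell_k-u_k)Y_{ij}-u_jY_{ik}+(\ell_i-u_i)Y_{jk}+(u_iu_k-\ell_i\ell_k)x_j+u_ju_kx_i+u_iu_jx_k-u_iu_ju_k,\\ h'^{3}_{ijk}&=-u_kY_{ij}+(\ell_j-u_j)Y_{ik}+(\ell_i-u_i)Y_{jk}+u_iu_kx_j+u_ju_kx_i+(u_iu_j-\ell_i\ell_j)x_k-u_iu_ju_k,\\ h'^{4}_{ijk}&=(u_j-\ell_j)Y_{ik}+(\ell_k-u_k)Y_{ij}+u_iY_{jk}+(\ell_ju_k-u_j\ell_k)x_i-u_i\ell_kx_j-u_iu_jx_k+u_iu_j\ell_k,\\ h'^{5}_{ijk}&=u_jY_{ik}+(\ell_k-u_k)Y_{ij}+(u_i-\ell_i)Y_{jk}-u_j\ell_kx_i+(\ell_iu_k-u_i\ell_k)x_j-u_iu_jx_k+u_iu_j\ell_k,\\ h'^{6}_{ijk}&=(u_k-\ell_k)Y_{ij}+u_iY_{jk}+(\ell_j-u_j)Y_{ik}-u_iu_kx_j+(u_j\ell_k-\ell_ju_k)x_i-u_i\ell_jx_k+u_i\ell_ju_k,\\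 h'^{7}_{ijk}&=u_kY_{ij}+(u_i-\ell_i)Y_{jk}+(\ell_j-u_j)Y_{ik}-u_iu_kx_j-\ell_ju_kx_i+(\ell_iu_j-u_i\ell_j)x_k+u_i\ell_ju_k,\\ h'^{8}_{ijk}&=(u_k-\ell_k)Y_{ij}+(\ell_i-u_i)Y_{jk}+u_jY_{ik}+(u_i\ell_k-\ell_iu_k)x_j-u_ju_kx_i-\ell_iu_jx_k+\ell_iu_ju_k,\\ h'^{9}_{ijk}&=u_kY_{ij}+(\ell_i-u_i)Y_{jk}+(u_j-\ell_j)Y_{ik}-\ell_iu_kx_j-u_ju_kx_i+(u_i\ell_j-\ell_iu_j)x_k+\ell_iu_ju_k,\\ h'^{10}_{ijk}&=-u_iY_{jk}+(u_j-\ell_j)Y_{ik}+(u_k-\ell_k)Y_{ij}+u_i\ell_kx_j+(\ell_j\ell_k-u_ju_k)x_i+u_i\ell_jx_k-u_i\ell_j\ell_k,\\ h'^{11}_{ijk}&=(u_i-\ell_i)Y_{jk}-u_jY_{ik}+(u_k-\ell_k)Y_{ij}+(\ell_i\ell_k-u_iu_k)x_j+u_j\ell_kx_i+\ell_iu_jx_k-\ell_iu_j\ell_k,\\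 h'^{12}_{ijk}&=-u_kY_{ij}+(u_i-\ell_i)Y_{jk}+(u_j-\ell_j)Y_{ik}+\ell_iu_kx_j+\ell_ju_kx_i+(\ell_i\ell_j-u_iu_j)x_k-\ell_i\ell_ju_k. \end{aligned}$$ Write $h^t_{ij}(x,Y)=\langle M^t_{ij},Y\rangle+(v^t_{ij})^Tx+l^t_{ij}$ and $h'^t_{ijk}(x,Y)=\langle M'^t_{ijk},Y\rangle+(v'^t_{ijk})^Tx+l'^t_{ijk}$ with symmetric matrices $M^t_{ij},M'^t_{ijk}$. For positive semidefinite $S_0,\dots,S_m$ let $v(P'_{S_0,\dots,S_m})$ be the optimal value of $$\begin{aligned}\min\ &\langle S_0,xx^T\rangle+c_0^Tx+\langle Q_0-S_0,Y\rangle\\ \text{s.t. }&\ell_i\le x_i\le u_i,\quad \langle S_r,xx^T\rangle+c_r^Tx+\langle Q_r-S_r,Y\rangle\le b_r\ (1\le r\le m),\\ &h^t_{ij}(x,Y)\le0\ (i\le j,\ 1\le t\le4),\quad h'^t_{ijk}(x,Y)\le0\ (i<j<k,\ 1\le t\le12),\quad Y_{ji}=Y_{ij}\ (i<j),\end{aligned}$$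 and let $(OPT)$ be the problem of maximizing $v(P'_{S_0,\dots,S_m})$ over all positive semidefinite $S_0,\dots,S_m$. Let $(SDP)$ be the problem $$\begin{aligned}\min\ &\langle Q_0,X\rangle+c_0^Tx\\ \text{s.t. }&\langle Q_r,X\rangle+c_r^Tx\le b_r\ (1\le r\le m),\quad X_{ii}-u_ix_i-\ell_ix_i+u_i\ell_i\le0,\quad -X_{ii}+2u_ix_i-u_i^2\le0,\quad -X_{ii}+2\ell_ix_i-\ell_i^2\le0\ (1\le i\le n),\\ &\begin{pmatrix}1&x^T\\x&X\end{pmatrix}\succeq0,\quad h^t_{ij}(x,X)\le0\ (i<j,\ 1\le t\le4),\quad h'^t_{ijk}(x,X)\le0\ (i<j<k,\ 1\le t\le12),\quad X=X^T.\end{aligned}$$ Its dual $(D)$ has the variables $\alpha_r\ge0$, $\varphi^1,\varphi^2,\varphi^3\in\mathbb{R}^n_+$, $\phi^t_{ij}\ge0$ ($i<j$), $\delta^t_{ijk}\ge0$ ($i<j<k$), associated in this order with the quadratic constraints, the three families of diagonal constraints, the McCormick constraints and the triangle constraints of $(SDP)$, and $\rho\in\mathbb{R}$. With $$\Phi=\sum_{i<j}\sum_{t=1}^4\phi^t_{ij}M^t_{ij}+\mathrm{diag}(\varphi^1-\varphi^2-\varphi^3),\qquad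 \Delta=\sum_{i<j<k}\sum_{t=1}^{12}\delta^t_{ijk}M'^t_{ijk},\qquad S=Q_0+\sum_{r=1}^m\alpha_rQ_r+\Phi+\Delta,$$ $$d=c_0+\sum_{r}\alpha_rc_r+\sum_{i<j,t}\phi^t_{ij}v^t_{ij}+\sum_{i<j<k,t}\delta^t_{ijk}v'^t_{ijk}+\big(-\varphi^1_i(u_i+\ell_i)+2\varphi^2_iu_i+2\varphi^3_i\ell_i\big)_{i=1}^n,$$ it is to maximize $$-\sum_r\alpha_rb_r+\sum_{i<j,t}\phi^t_{ij}l^t_{ij}+\sum_{i<j<k,t}\delta^t_{ijk}l'^t_{ijk}+\sum_i\big(u_i\ell_i\varphi^1_i-u_i^2\varphi^2_i-\ell_i^2\varphi^3_i\big)-\rho\quad\text{s.t.}\quad\begin{pmatrix}\rho&\frac12d^T\\\frac12d&S\end{pmatrix}\succeq0.$$ Let $(\alpha^*,\phi^*,\varphi^{1*},\varphi^{2*},\varphi^{3*},\delta^*,\rho^*)$ be optimal dual variables, that is, an optimal solution of $(D)$, let $\Phi^*,\Delta^*$ be the corresponding matrices, and put $$S_0^*=Q_0+\sum_{r=1}^m\alpha^*_rQ_r+\Phi^*+\Delta^*,\qquad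 S_r^*=0\quad(r=1,\dots,m).$$ Then $S_0^*,\dots,S_m^*$ are positive semidefinite and form an optimal solution of $(OPT)$, so that $v(OPT)=v(P'_{S_0^*,\dots,S_m^*})$, and this value equals $v(SDP)$. Moreover the problem $$\begin{aligned}(P^*)\quad\min\ &\langle S_0^*,xx^T\rangle+c_0^Tx+\Big\langle-\sum_{r=1}^m\alpha^*_rQ_r-\Phi^*-\Delta^*,Y\Big\rangle\\ \text{s.t. }&\langle Q_r,Y\rangle+c_r^Tx\le b_r\ (1\le r\le m),\quad h^t_{ij}(x,Y)\le0\ (i\le j,\ 1\le t\le4),\quad h'^t_{ijk}(x,Y)\le0\ (i<j<k,\ 1\le t\le12),\quad Y_{ji}=Y_{ij}\ (i<j)\end{aligned}$$ has the same optimal value as $(SDP)$. -/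

import Mathlib

open Finset Matrix

noncomputable section

/-- The inner product `⟨A, B⟩ = ∑ i, ∑ j, a_ij * b_ij` of two square matrices. -/
def frob {n : ℕ} (A B : Matrix (Fin n) (Fin n) ℝ) : ℝ := ∑ i, ∑ j, A i j * B i j

/-- The optimal value of `min f z` subject to `z ∈ F`, as an extended real number
(`⊤` if `F` is empty, `⊥` if the problem is unbounded). -/
def optValue {E : Type*} (F : Set E) (f : E → ℝ) : EReal := ⨅ z ∈ F, (f z : EReal)

/-- The data of a quadratically constrained quadratic program in `n` bounded variables with `m`
quadratic constraints: minimize `⟨Q₀, xxᵀ⟩ + c₀ᵀx` subject to `⟨Q_r, xxᵀ⟩ + c_rᵀx ≤ b_r`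
and `l ≤ x ≤ u`, with symmetric matrices. -/
structure QCQP (n m : ℕ) where
  Q₀ : Matrix (Fin n) (Fin n) ℝ
  c₀ : Fin n → ℝ
  Q : Fin m → Matrix (Fin n) (Fin n) ℝ
  c : Fin m → Fin n → ℝ
  b : Fin m → ℝ
  l : Fin n → ℝ
  u : Fin n → ℝ
  symm_Q₀ : Q₀.IsSymm
  symm_Q : ∀ r, (Q r).IsSymm

namespace QCQP

variable {n m : ℕ} (P : QCQP n m)

/-- The feasible domain of the quadratic program `(P)` itself. -/
def feasibleSet : Set (Fin n → ℝ) :=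
  {x | (∀ r, frob (P.Q r) (vecMulVec x x) + P.c r ⬝ᵥ x ≤ P.b r) ∧
    ∀ i, P.l i ≤ x i ∧ x i ≤ P.u i}

/-! ### McCormick and general triangle inequalities -/

/-- The McCormick functions `h^t_ij(x, Y)`, `t = 1, …, 4`. -/
def mc (i j : Fin n) (x : Fin n → ℝ) (Y : Matrix (Fin n) (Fin n) ℝ) : Fin 4 → ℝ :=
  ![Y i j - P.u j * x i - P.l i * x j + P.u j * P.l i,
    Y i j - P.u i * x j - P.l j * x i + P.u i * P.l j,
    -Y i j + P.u j * x i + P.u i * x j - P.u i * P.u j,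
    -Y i j + P.l j * x i + P.l i * x j - P.l i * P.l j]

/-- The general triangle functions `h'^t_ijk(x, Y)`, `t = 1, …, 12`. -/
def tri (i j k : Fin n) (x : Fin n → ℝ) (Y : Matrix (Fin n) (Fin n) ℝ) : Fin 12 → ℝ :=
  let l := P.l
  let u := P.u
  ![(l k - u k) * Y i j + (l j - u j) * Y i k - u i * Y j k + u i * u k * x j
      + (u j * u k - l j * l k) * x i + u i * u j * x k - u i * u j * u k,
    (l k - u k) * Y i j - u j * Y i k + (l i - u i) * Y j k + (u i * u k - l i * l k) * x j
      + u j * u k * x i + u i * u j * x k - u i * u j * u k,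
    -(u k * Y i j) + (l j - u j) * Y i k + (l i - u i) * Y j k + u i * u k * x j
      + u j * u k * x i + (u i * u j - l i * l j) * x k - u i * u j * u k,
    (u j - l j) * Y i k + (l k - u k) * Y i j + u i * Y j k + (l j * u k - u j * l k) * x i
      - u i * l k * x j - u i * u j * x k + u i * u j * l k,
    u j * Y i k + (l k - u k) * Y i j + (u i - l i) * Y j k - u j * l k * x i
      + (l i * u k - u i * l k) * x j - u i * u j * x k + u i * u j * l k,
    (u k - l k) * Y i j + u i * Y j k + (l j - u j) * Y i k - u i * u k * x j
      + (u j * l k - l j * u k) * x i - u i * l j * x k + u i * l j * u k,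
    u k * Y i j + (u i - l i) * Y j k + (l j - u j) * Y i k - u i * u k * x j
      - l j * u k * x i + (l i * u j - u i * l j) * x k + u i * l j * u k,
    (u k - l k) * Y i j + (l i - u i) * Y j k + u j * Y i k + (u i * l k - l i * u k) * x j
      - u j * u k * x i - l i * u j * x k + l i * u j * u k,
    u k * Y i j + (l i - u i) * Y j k + (u j - l j) * Y i k - l i * u k * x j
      - u j * u k * x i + (u i * l j - l i * u j) * x k + l i * u j * u k,
    -(u i * Y j k) + (u j - l j) * Y i k + (u k - l k) * Y i j + u i * l k * x j
      + (l j * l k - u j * u k) * x i + u i * l j * x k - u i * l j * l k,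
    (u i - l i) * Y j k - u j * Y i k + (u k - l k) * Y i j + (l i * l k - u i * u k) * x j
      + u j * l k * x i + l i * u j * x k - l i * u j * l k,
    -(u k * Y i j) + (u i - l i) * Y j k + (u j - l j) * Y i k + l i * u k * x j
      + l j * u k * x i + (l i * l j - u i * u j) * x k - l i * l j * u k]

/-! ### The coefficients `M`, `v`, `l` of these affine functions -/

/-- The symmetric matrix `E` with `⟨E, X⟩ = X_ij` for symmetric `X`. -/
def symE (i j : Fin n) : Matrix (Fin n) (Fin n) ℝ :=
  (1 / 2 : ℝ) • (Matrix.single i j 1 + Matrix.single j i 1)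

/-- The matrices `M^t_ij`. -/
def mcM (i j : Fin n) : Fin 4 → Matrix (Fin n) (Fin n) ℝ :=
  ![symE i j, symE i j, -symE i j, -symE i j]

/-- The vectors `v^t_ij`. -/
def mcV (i j : Fin n) : Fin 4 → Fin n → ℝ :=
  ![Pi.single i (-P.u j) + Pi.single j (-P.l i),
    Pi.single i (-P.l j) + Pi.single j (-P.u i),
    Pi.single i (P.u j) + Pi.single j (P.u i),
    Pi.single i (P.l j) + Pi.single j (P.l i)]

/-- The scalars `l^t_ij`. -/
def mcL (i j : Fin n) : Fin 4 → ℝ :=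
  ![P.u j * P.l i, P.u i * P.l j, -(P.u i * P.u j), -(P.l i * P.l j)]

/-- The coefficients of `Y_ij`, `Y_ik`, `Y_jk` (in this order) in `h'^t_ijk`. -/
def triY (i j k : Fin n) : Fin 12 → Fin 3 → ℝ :=
  let l := P.l
  let u := P.u
  ![![l k - u k, l j - u j, -u i],
    ![l k - u k, -u j, l i - u i],
    ![-u k, l j - u j, l i - u i],
    ![l k - u k, u j - l j, u i],
    ![l k - u k, u j, u i - l i],
    ![u k - l k, l j - u j, u i],
    ![u k, l j - u j, u i - l i],
    ![u k - l k, u j, l i - u i],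
    ![u k, u j - l j, l i - u i],
    ![u k - l k, u j - l j, -u i],
    ![u k - l k, -u j, u i - l i],
    ![-u k, u j - l j, u i - l i]]

/-- The coefficients of `x_i`, `x_j`, `x_k` (in this order) in `h'^t_ijk`. -/
def triX (i j k : Fin n) : Fin 12 → Fin 3 → ℝ :=
  let l := P.l
  let u := P.u
  ![![u j * u k - l j * l k, u i * u k, u i * u j],
    ![u j * u k, u i * u k - l i * l k, u i * u j],
    ![u j * u k, u i * u k, u i * u j - l i * l j],
    ![l j * u k - u j * l k, -(u i * l k), -(u i * u j)],
    ![-(u j * l k), l i * u k - u i * l k, -(u i * u j)],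
    ![u j * l k - l j * u k, -(u i * u k), -(u i * l j)],
    ![-(l j * u k), -(u i * u k), l i * u j - u i * l j],
    ![-(u j * u k), u i * l k - l i * u k, -(l i * u j)],
    ![-(u j * u k), -(l i * u k), u i * l j - l i * u j],
    ![l j * l k - u j * u k, u i * l k, u i * l j],
    ![u j * l k, l i * l k - u i * u k, l i * u j],
    ![l j * u k, l i * u k, l i * l j - u i * u j]]

/-- The matrices `M'^t_ijk`. -/
def triM (i j k : Fin n) (t : Fin 12) : Matrix (Fin n) (Fin n) ℝ :=
  P.triY i j k t 0 • symE i j + P.triY i j k t 1 • symE i k + P.triY i j k t 2 • symE j k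

/-- The vectors `v'^t_ijk`. -/
def triV (i j k : Fin n) (t : Fin 12) : Fin n → ℝ :=
  Pi.single i (P.triX i j k t 0) + Pi.single j (P.triX i j k t 1)
    + Pi.single k (P.triX i j k t 2)

/-- The scalars `l'^t_ijk`. -/
def triL (i j k : Fin n) : Fin 12 → ℝ :=
  let l := P.l
  let u := P.u
  ![-(u i * u j * u k), -(u i * u j * u k), -(u i * u j * u k),
    u i * u j * l k, u i * u j * l k, u i * l j * u k, u i * l j * u k,
    l i * u j * u k, l i * u j * u k, -(u i * l j * l k), -(l i * u j * l k), -(l i * l j * u k)]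

theorem frob_add (A B X : Matrix (Fin n) (Fin n) ℝ) :
    frob (A + B) X = frob A X + frob B X := by
  simp [frob, add_mul, Finset.sum_add_distrib]

theorem frob_smul (a : ℝ) (A X : Matrix (Fin n) (Fin n) ℝ) :
    frob (a • A) X = a * frob A X := by
  simp [frob, Finset.mul_sum, mul_assoc]

theorem frob_neg (A X : Matrix (Fin n) (Fin n) ℝ) : frob (-A) X = -frob A X := by
  simp [frob]

theorem frob_single (i j : Fin n) (X : Matrix (Fin n) (Fin n) ℝ) :
    frob (Matrix.single i j 1) X = X i j := by
  simp [frob, Matrix.single_apply, ite_and]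

theorem frob_symE (i j : Fin n) {X : Matrix (Fin n) (Fin n) ℝ} (hX : X.IsSymm) :
    frob (symE i j) X = X i j := by
  rw [symE, frob_smul, frob_add, frob_single, frob_single, hX.apply i j]
  ring

theorem symE_isSymm (i j : Fin n) : (symE i j).IsSymm := by
  simp [symE, Matrix.IsSymm, Matrix.transpose_add, add_comm]

/-- `M^t_ij`, `v^t_ij`, `l^t_ij` are the coefficients of `h^t_ij`. -/
theorem mc_eq (i j : Fin n) (t : Fin 4) (x : Fin n → ℝ) {X : Matrix (Fin n) (Fin n) ℝ}
    (hX : X.IsSymm) :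
    P.mc i j x X t = frob (mcM i j t) X + P.mcV i j t ⬝ᵥ x + P.mcL i j t := by
  fin_cases t <;>
    simp [mc, mcM, mcV, mcL, frob_neg, frob_symE i j hX, add_dotProduct,
      single_dotProduct] <;> ring

/-- `M'^t_ijk`, `v'^t_ijk`, `l'^t_ijk` are the coefficients of `h'^t_ijk`. -/
theorem tri_eq (i j k : Fin n) (t : Fin 12) (x : Fin n → ℝ) {X : Matrix (Fin n) (Fin n) ℝ}
    (hX : X.IsSymm) :
    P.tri i j k x X t = frob (P.triM i j k t) X + P.triV i j k t ⬝ᵥ x + P.triL i j k t := by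
  simp only [triM, triV, frob_add, frob_smul, frob_symE i j hX, frob_symE i k hX,
    frob_symE j k hX, add_dotProduct, single_dotProduct]
  fin_cases t <;> simp [tri, triY, triX, triL] <;> ring

/-! ### The family of quadratic convex relaxations and the problem `(OPT)` -/

/-- The feasible set of `(P'_{S₀,…,S_m})`. It does not depend on `S₀`. -/
def relaxFeasible (S : Fin m → Matrix (Fin n) (Fin n) ℝ) :
    Set ((Fin n → ℝ) × Matrix (Fin n) (Fin n) ℝ) :=
  {z | (∀ i, P.l i ≤ z.1 i ∧ z.1 i ≤ P.u i) ∧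
    (∀ r, frob (S r) (vecMulVec z.1 z.1) + P.c r ⬝ᵥ z.1 + frob (P.Q r - S r) z.2 ≤ P.b r) ∧
    (∀ i j, i ≤ j → ∀ t, P.mc i j z.1 z.2 t ≤ 0) ∧
    (∀ i j k, i < j → j < k → ∀ t, P.tri i j k z.1 z.2 t ≤ 0) ∧
    (∀ i j, i < j → z.2 j i = z.2 i j)}

/-- The optimal value `v(P'_{S₀,…,S_m})`. -/
def relaxValue (S₀ : Matrix (Fin n) (Fin n) ℝ) (S : Fin m → Matrix (Fin n) (Fin n) ℝ) : EReal :=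
  optValue (P.relaxFeasible S)
    (fun z => frob S₀ (vecMulVec z.1 z.1) + P.c₀ ⬝ᵥ z.1 + frob (P.Q₀ - S₀) z.2)

/-- Feasible points of `(OPT)`: all the matrices `S₀, …, S_m` are positive semidefinite. -/
def OptFeasible (S₀ : Matrix (Fin n) (Fin n) ℝ) (S : Fin m → Matrix (Fin n) (Fin n) ℝ) : Prop :=
  S₀.PosSemidef ∧ ∀ r, (S r).PosSemidef

/-- The optimal value `v(OPT)` of the maximization problem `(OPT)`. -/
def optOptValue : EReal :=
  ⨆ (S₀ : Matrix (Fin n) (Fin n) ℝ) (S : Fin m → Matrix (Fin n) (Fin n) ℝ)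
    (_ : OptFeasible S₀ S), P.relaxValue S₀ S

/-- `(S₀, …, S_m)` is an optimal solution of `(OPT)`. -/
def IsOptSolution (S₀ : Matrix (Fin n) (Fin n) ℝ) (S : Fin m → Matrix (Fin n) (Fin n) ℝ) :
    Prop :=
  OptFeasible S₀ S ∧ ∀ S₀' S', OptFeasible S₀' S' → P.relaxValue S₀' S' ≤ P.relaxValue S₀ S

/-! ### The semidefinite relaxation `(SDP)` -/

/-- The block matrix with rows `(ρ, wᵀ)` and `(w, X)`. -/
def bordered (ρ : ℝ) (w : Fin n → ℝ) (X : Matrix (Fin n) (Fin n) ℝ) :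
    Matrix (Unit ⊕ Fin n) (Unit ⊕ Fin n) ℝ :=
  Matrix.fromBlocks (Matrix.of fun _ _ => ρ) (Matrix.of fun _ i => w i)
    (Matrix.of fun i _ => w i) X

/-- The feasible set of the "Shor plus RLT plus Triangle" semidefinite relaxation. -/
def sdpFeasible : Set ((Fin n → ℝ) × Matrix (Fin n) (Fin n) ℝ) :=
  {z | (∀ r, frob (P.Q r) z.2 + P.c r ⬝ᵥ z.1 ≤ P.b r) ∧
    (∀ i, z.2 i i - P.u i * z.1 i - P.l i * z.1 i + P.u i * P.l i ≤ 0) ∧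
    (∀ i, -z.2 i i + 2 * P.u i * z.1 i - P.u i ^ 2 ≤ 0) ∧
    (∀ i, -z.2 i i + 2 * P.l i * z.1 i - P.l i ^ 2 ≤ 0) ∧
    z.2.IsSymm ∧
    (bordered 1 z.1 z.2).PosSemidef ∧
    (∀ i j, i < j → ∀ t, P.mc i j z.1 z.2 t ≤ 0) ∧
    (∀ i j k, i < j → j < k → ∀ t, P.tri i j k z.1 z.2 t ≤ 0)}

/-- The optimal value `v(SDP)`. -/
def sdpValue : EReal :=
  optValue P.sdpFeasible (fun z => frob P.Q₀ z.2 + P.c₀ ⬝ᵥ z.1)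

/-! ### The dual `(D)` of `(SDP)` -/

/-- The dual variables of `(SDP)`: `α` for the quadratic constraints, `φ i j t` (only `i < j`
matters) for the McCormick constraints, `φ₁, φ₂, φ₃` for the three families of constraints on the
diagonal of `X`, `δ i j k t` (only `i < j < k` matters) for the triangle constraints, and `ρ`. -/
structure DualVars (n m : ℕ) where
  α : Fin m → ℝ
  φ : Fin n → Fin n → Fin 4 → ℝ
  φ₁ : Fin n → ℝ
  φ₂ : Fin n → ℝ
  φ₃ : Fin n → ℝ
  δ : Fin n → Fin n → Fin n → Fin 12 → ℝ
  ρ : ℝ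

/-- `Φ = ∑_{i<j} ∑_t φ^t_ij M^t_ij + diag(φ¹ - φ² - φ³)`. -/
def Phi (D : DualVars n m) : Matrix (Fin n) (Fin n) ℝ :=
  (∑ i, ∑ j ∈ Finset.Ioi i, ∑ t, D.φ i j t • mcM i j t)
    + Matrix.diagonal (D.φ₁ - D.φ₂ - D.φ₃)

/-- `Δ = ∑_{i<j<k} ∑_t δ^t_ijk M'^t_ijk`. -/
def Delta (D : DualVars n m) : Matrix (Fin n) (Fin n) ℝ :=
  ∑ i, ∑ j ∈ Finset.Ioi i, ∑ k ∈ Finset.Ioi j, ∑ t, D.δ i j k t • P.triM i j k t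

/-- `S = Q₀ + ∑_r α_r Q_r + Φ + Δ`. -/
def dualS (D : DualVars n m) : Matrix (Fin n) (Fin n) ℝ :=
  P.Q₀ + ∑ r, D.α r • P.Q r + Phi D + P.Delta D

/-- The coefficient vector `d` of `x` in the Lagrangian. -/
def dualD (D : DualVars n m) : Fin n → ℝ :=
  P.c₀ + ∑ r, D.α r • P.c r
    + (∑ i, ∑ j ∈ Finset.Ioi i, ∑ t, D.φ i j t • P.mcV i j t)
    + (∑ i, ∑ j ∈ Finset.Ioi i, ∑ k ∈ Finset.Ioi j, ∑ t, D.δ i j k t • P.triV i j k t)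
    - D.φ₁ * (P.u + P.l) + (2 : ℝ) • (D.φ₂ * P.u) + (2 : ℝ) • (D.φ₃ * P.l)

/-- The objective function of `(D)`. -/
def dualObj (D : DualVars n m) : ℝ :=
  -(∑ r, D.α r * P.b r)
    + (∑ i, ∑ j ∈ Finset.Ioi i, ∑ t, D.φ i j t * P.mcL i j t)
    + (∑ i, ∑ j ∈ Finset.Ioi i, ∑ k ∈ Finset.Ioi j, ∑ t, D.δ i j k t * P.triL i j k t)
    + (∑ i, P.u i * P.l i * D.φ₁ i) - (∑ i, P.u i ^ 2 * D.φ₂ i)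
    - (∑ i, P.l i ^ 2 * D.φ₃ i) - D.ρ

/-- Feasibility for `(D)`. -/
def DualFeasible (D : DualVars n m) : Prop :=
  (∀ r, 0 ≤ D.α r) ∧
  (∀ i j, i < j → ∀ t, 0 ≤ D.φ i j t) ∧
  (∀ i, 0 ≤ D.φ₁ i) ∧ (∀ i, 0 ≤ D.φ₂ i) ∧ (∀ i, 0 ≤ D.φ₃ i) ∧
  (∀ i j k, i < j → j < k → ∀ t, 0 ≤ D.δ i j k t) ∧
  (bordered D.ρ ((1 / 2 : ℝ) • P.dualD D) (P.dualS D)).PosSemidef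

/-- `D` consists of optimal dual variables of `(SDP)`: it is an optimal solution of `(D)`. -/
def IsDualOptimal (D : DualVars n m) : Prop :=
  P.DualFeasible D ∧ ∀ D', P.DualFeasible D' → P.dualObj D' ≤ P.dualObj D

/-! ### The relaxation `(P*)` -/

/-- The feasible set of `(P*)`. -/
def starFeasible : Set ((Fin n → ℝ) × Matrix (Fin n) (Fin n) ℝ) :=
  {z | (∀ r, frob (P.Q r) z.2 + P.c r ⬝ᵥ z.1 ≤ P.b r) ∧
    (∀ i j, i ≤ j → ∀ t, P.mc i j z.1 z.2 t ≤ 0) ∧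
    (∀ i j k, i < j → j < k → ∀ t, P.tri i j k z.1 z.2 t ≤ 0) ∧
    (∀ i j, i < j → z.2 j i = z.2 i j)}

/-- The optimal value of `(P*)` built from the dual variables `D`. -/
def starValue (D : DualVars n m) : EReal :=
  optValue P.starFeasible
    (fun z => frob (P.Q₀ + ∑ r, D.α r • P.Q r + Phi D + P.Delta D) (vecMulVec z.1 z.1)
      + P.c₀ ⬝ᵥ z.1 + frob (-(∑ r, D.α r • P.Q r) - Phi D - P.Delta D) z.2)

end QCQP

end

/-!
The theorem follows from the chain
`v(SDP) ≤ v(D) ≤ v(P*) ≤ v(P'_{S₀*, 0, …, 0}) ≤ v(SDP)`, whose last inequality holds for every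
choice of positive semidefinite `S₀, …, S_m`: a feasible `(x, X)` of `(SDP)` satisfies `xxᵀ ⪯ X`, so
that `⟨S_r, xxᵀ⟩ ≤ ⟨S_r, X⟩`.

Nonnegative dual variables are feasible for `(D)` exactly when their objective value bounds the
Lagrangian of `(SDP)` from below on all pairs with `xxᵀ ⪯ X`; evaluating the quadratic form of the
dual matrix constraint at `x` alone gives `v(D) ≤ v(P*)`. The inequality `v(SDP) ≤ v(D)` is strong
duality, obtained from compactness instead of an interior point: if `v < v(SDP)`, the vectors
`(f z - v, g z)` of objective and constraint values, together with everything above them, stay away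
from `0`, because the points with `g z ≤ 1` form a compact set. Separation yields multipliers
`(c₀, c) ≥ 0` with `c₀ (f z - v) + c ⬝ᵥ g z ≥ ε > 0`, and adding a small multiple of a known dual
point makes `c₀` positive.
-/

section ConvexDuality

open scoped Topology

theorem convex_upperClosure_image {E κ : Type*} [AddCommGroup E] [Module ℝ E]
    {C : Set E} {G : E → κ → ℝ} (hG : ConvexOn ℝ C G) :
    Convex ℝ (upperClosure (G '' C) : Set (κ → ℝ)) := by
  have himage : (upperClosure (G '' C) : Set (κ → ℝ))
      = LinearMap.snd ℝ E (κ → ℝ) '' {p | p.1 ∈ C ∧ G p.1 ≤ p.2} := by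
    ext y
    simp
  rw [himage]
  exact hG.convex_epigraph.linear_image _

theorem zero_notMem_closure_upperClosure_image {E κ : Type*} [TopologicalSpace E] [Finite κ]
    {C : Set E} {G : E → κ → ℝ} (hG : ContinuousOn G C) (hK : IsCompact {z ∈ C | G z ≤ 1})
    (h : ∀ z ∈ C, ¬ G z ≤ 0) : (0 : κ → ℝ) ∉ closure (upperClosure (G '' C) : Set (κ → ℝ)) := by
  cases nonempty_fintype κ
  set K := {z ∈ C | G z ≤ 1}
  have hGK : IsCompact (G '' K) := hK.image_of_continuousOn (hG.mono fun z hz => hz.1)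
  have hclosed : IsClosed (upperClosure (G '' K) : Set (κ → ℝ)) :=
    hGK.isClosed.upperClosure_pi hGK.isBounded.bddBelow
  have hzero : (0 : κ → ℝ) ∈ (upperClosure (G '' K) : Set (κ → ℝ))ᶜ := by
    rintro ⟨_, ⟨z, hz, rfl⟩, hz0⟩
    exact h z hz.1 hz0
  have hnhds : (upperClosure (G '' K) : Set (κ → ℝ))ᶜ ∩ Set.Iic 1 ∈ 𝓝 (0 : κ → ℝ) :=
    Filter.inter_mem (hclosed.isOpen_compl.mem_nhds hzero)
      (pi_Iic_mem_nhds fun _ => zero_lt_one)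
  rw [mem_closure_iff_nhds]
  intro hcl
  obtain ⟨y, ⟨hyK, hy1⟩, _, ⟨z, hz, rfl⟩, hzy⟩ := hcl _ hnhds
  exact hyK ⟨G z, ⟨z, ⟨hz, hzy.trans hy1⟩, rfl⟩, hzy⟩

theorem exists_nonneg_separating_vector {κ : Type*} [Fintype κ] (A : UpperSet (κ → ℝ))
    (hconv : Convex ℝ (A : Set (κ → ℝ))) (h0 : (0 : κ → ℝ) ∉ closure (A : Set (κ → ℝ))) :
    ∃ c : κ → ℝ, 0 ≤ c ∧ ∃ ε > 0, ∀ y ∈ A, ε ≤ c ⬝ᵥ y := by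
  classical
  rcases (A : Set (κ → ℝ)).eq_empty_or_nonempty with hA | ⟨y, hy⟩
  · exact ⟨0, le_rfl, 1, one_pos, fun y hy => (Set.eq_empty_iff_forall_notMem.1 hA y hy).elim⟩
  obtain ⟨L, ε, hL0, hL⟩ := geometric_hahn_banach_point_closed hconv.closure isClosed_closure h0
  have hLc : ∀ y, L y = (fun i => L (Pi.single i 1)) ⬝ᵥ y := fun y => by
    conv_lhs => rw [pi_eq_sum_univ' y]
    simp [dotProduct, mul_comm]
  refine ⟨fun i => L (Pi.single i 1), fun i => ?_, ε, by simpa using hL0, fun y hy => ?_⟩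
  · by_contra! hneg
    obtain ⟨s, hs⟩ := exists_lt_nsmul (neg_pos.2 hneg) (L y - ε)
    have hmem : y + s • Pi.single i 1 ∈ A :=
      A.upper (le_add_of_nonneg_right (nsmul_nonneg (Pi.single_nonneg.2 zero_le_one) s)) hy
    have hlt := hL _ (subset_closure hmem)
    rw [map_add, map_nsmul] at hlt
    rw [smul_neg] at hs
    linarith
  · rw [← hLc]
    exact (hL y (subset_closure hy)).le

theorem exists_nonneg_forall_le_dotProduct {E κ : Type*} [AddCommGroup E] [Module ℝ E]
    [TopologicalSpace E] [Fintype κ] {C : Set E} {G : E → κ → ℝ} (hconv : ConvexOn ℝ C G)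
    (hcont : ContinuousOn G C) (hK : IsCompact {z ∈ C | G z ≤ 1}) (h : ∀ z ∈ C, ¬ G z ≤ 0) :
    ∃ c : κ → ℝ, 0 ≤ c ∧ ∃ ε > 0, ∀ z ∈ C, ε ≤ c ⬝ᵥ G z := by
  obtain ⟨c, hc, ε, hε, hle⟩ := exists_nonneg_separating_vector _
    (convex_upperClosure_image hconv) (zero_notMem_closure_upperClosure_image hcont hK h)
  exact ⟨c, hc, ε, hε, fun z hz => hle _ (subset_upperClosure ⟨z, hz, rfl⟩)⟩

variable {E ι : Type*} [AddCommGroup E] [Module ℝ E] [TopologicalSpace E] [Fintype ι]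
  {C : Set E} {f : E → ℝ} {g : E → ι → ℝ}

theorem exists_fritz_john_multipliers (hf : ConvexOn ℝ C f) (hg : ConvexOn ℝ C g)
    (hfc : ContinuousOn f C) (hgc : ContinuousOn g C) (hK : IsCompact {z ∈ C | g z ≤ 1}) {v : ℝ}
    (hv : ∀ z ∈ C, g z ≤ 0 → v < f z) :
    ∃ c₀ : ℝ, 0 ≤ c₀ ∧ ∃ c : ι → ℝ, 0 ≤ c ∧ ∃ ε > 0, ∀ z ∈ C, ε ≤ c₀ * (f z - v) + c ⬝ᵥ g z := by
  let G : E → Option ι → ℝ := fun z o => o.elim (f z - v) (g z)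
  have hG : ConvexOn ℝ C G := ⟨hf.1, fun x hx y hy a b ha hb hab o => by
    cases o with
    | none => exact (hf.add_const (-v)).2 hx hy ha hb hab
    | some i => exact hg.2 hx hy ha hb hab i⟩
  have hGc : ContinuousOn G C := continuousOn_pi.2 fun o => by
    cases o with
    | none => exact hfc.sub continuousOn_const
    | some i => exact continuousOn_pi.1 hgc i
  have hGK : IsCompact {z ∈ C | G z ≤ 1} := by
    convert (hfc.mono (Set.sep_subset _ _)).lowerSemicontinuousOn.isCompact_inter_preimage_Iic hK
      (1 + v) using 1
    ext z
    simp [G, Pi.le_def, Option.forall, and_assoc, and_comm (a := f z ≤ 1 + v)]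
  have hG0 : ∀ z ∈ C, ¬ G z ≤ 0 := fun z hz hle =>
    (hv z hz fun i => hle (some i)).not_ge (sub_nonpos.1 (hle none))
  obtain ⟨c, hc, ε, hε, hle⟩ := exists_nonneg_forall_le_dotProduct hG hGc hGK hG0
  refine ⟨c none, hc none, c ∘ some, fun i => hc (some i), ε, hε, fun z hz => ?_⟩
  have h := hle z hz
  rwa [dotProduct, Fintype.sum_option] at h

theorem exists_lagrange_multipliers (hf : ConvexOn ℝ C f) (hg : ConvexOn ℝ C g)
    (hfc : ContinuousOn f C) (hgc : ContinuousOn g C) (hK : IsCompact {z ∈ C | g z ≤ 1})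
    {k : ι → ℝ} (hk : 0 ≤ k) {v₀ : ℝ} (hv₀ : ∀ z ∈ C, v₀ ≤ f z + k ⬝ᵥ g z)
    {v : ℝ} (hv : ∀ z ∈ C, g z ≤ 0 → v < f z) :
    ∃ c : ι → ℝ, 0 ≤ c ∧ ∀ z ∈ C, v ≤ f z + c ⬝ᵥ g z := by
  obtain ⟨c₀, hc₀, c, hc, ε, hε, hle⟩ := exists_fritz_john_multipliers hf hg hfc hgc hK hv
  obtain ⟨δ, hδ, hδε⟩ : ∃ δ > 0, δ * (v - v₀) ≤ ε := by
    refine ⟨ε / (1 + |v - v₀|), by positivity, ?_⟩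
    rw [div_mul_eq_mul_div, div_le_iff₀ (by positivity)]
    gcongr
    linarith [le_abs_self (v - v₀)]
  -- A small multiple of the dual point `k` makes the multiplier of `f` positive.
  have hpos : 0 < c₀ + δ := add_pos_of_nonneg_of_pos hc₀ hδ
  refine ⟨(c₀ + δ)⁻¹ • (c + δ • k),
    smul_nonneg (inv_nonneg.2 hpos.le) (add_nonneg hc (smul_nonneg hδ.le hk)), fun z hz => ?_⟩
  have hsum : (c₀ + δ) * v ≤ (c₀ + δ) * f z + (c + δ • k) ⬝ᵥ g z := by
    rw [add_dotProduct, smul_dotProduct, smul_eq_mul]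
    linarith [hle z hz, mul_le_mul_of_nonneg_left (hv₀ z hz) hδ.le]
  rw [smul_dotProduct, smul_eq_mul, ← mul_le_mul_iff_right₀ hpos, mul_add,
    mul_inv_cancel_left₀ hpos.ne']
  exact hsum

end ConvexDuality

noncomputable section

section Frobenius

variable {n : ℕ}

theorem frob_comm (A B : Matrix (Fin n) (Fin n) ℝ) : frob A B = frob B A := by
  simp only [frob, mul_comm]

theorem frob_sub_left (A B X : Matrix (Fin n) (Fin n) ℝ) :
    frob (A - B) X = frob A X - frob B X := by
  rw [sub_eq_add_neg, QCQP.frob_add, QCQP.frob_neg, sub_eq_add_neg]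

theorem frob_sub_right (A X Y : Matrix (Fin n) (Fin n) ℝ) :
    frob A (X - Y) = frob A X - frob A Y := by
  simp only [frob_comm A, frob_sub_left]

theorem frob_add_right (A X Y : Matrix (Fin n) (Fin n) ℝ) :
    frob A (X + Y) = frob A X + frob A Y := by
  simp only [frob_comm A, QCQP.frob_add]

theorem frob_smul_right (a : ℝ) (A X : Matrix (Fin n) (Fin n) ℝ) :
    frob A (a • X) = a * frob A X := by
  simp only [frob_comm A, QCQP.frob_smul]

theorem frob_vecMulVec (A : Matrix (Fin n) (Fin n) ℝ) (y : Fin n → ℝ) :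
    frob A (vecMulVec y y) = y ⬝ᵥ A *ᵥ y := by
  simp only [frob, vecMulVec_apply, dotProduct, mulVec, Finset.mul_sum]
  exact Finset.sum_congr rfl fun i _ => Finset.sum_congr rfl fun j _ => by ring

theorem frob_nonneg {A B : Matrix (Fin n) (Fin n) ℝ} (hA : A.PosSemidef) (hB : B.PosSemidef) :
    0 ≤ frob A B := by
  simpa [frob, dotProduct, mulVec] using (hA.hadamard hB).dotProduct_mulVec_nonneg 1

end Frobenius

theorem two_mul_abs_le_diag_add_diag {ι : Type*} [Finite ι] {X : Matrix ι ι ℝ}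
    (hX : X.PosSemidef) (i j : ι) : 2 * |X i j| ≤ X i i + X j j := by
  classical
  cases nonempty_fintype ι
  have hsymm : X j i = X i j := by simpa using hX.1.apply i j
  have hadd := hX.dotProduct_mulVec_nonneg (Pi.single i 1 + Pi.single j 1)
  have hsub := hX.dotProduct_mulVec_nonneg (Pi.single i 1 - Pi.single j 1)
  simp only [star_trivial, mulVec_add, mulVec_sub, mulVec_single, MulOpposite.op_one, one_smul,
    dotProduct_add, dotProduct_sub, add_dotProduct, sub_dotProduct, single_dotProduct, col_apply,
    one_mul, hsymm] at hadd hsub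
  rcases abs_cases (X i j) with h | h <;> linarith

theorem isSymm_of_forall_lt {ι α : Type*} [LinearOrder ι] {Y : Matrix ι ι α}
    (h : ∀ i j, i < j → Y j i = Y i j) : Y.IsSymm := by
  refine IsSymm.ext fun i j => ?_
  rcases lt_trichotomy i j with hij | rfl | hij
  · exact h i j hij
  · rfl
  · exact (h j i hij).symm

namespace QCQP

variable {n : ℕ}

theorem dotProduct_bordered_mulVec (ρ : ℝ) (w : Fin n → ℝ) (X : Matrix (Fin n) (Fin n) ℝ)
    (t : ℝ) (y : Fin n → ℝ) :
    Sum.elim (fun _ => t) y ⬝ᵥ bordered ρ w X *ᵥ Sum.elim (fun _ => t) y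
      = ρ * t ^ 2 + 2 * t * (w ⬝ᵥ y) + frob X (vecMulVec y y) := by
  have hcol : (Matrix.of fun i (_ : Unit) => w i) *ᵥ (fun _ => t) = t • w := by
    ext i
    simp [mulVec, dotProduct, mul_comm]
  have hrow : (Matrix.of fun (_ : Unit) i => w i) *ᵥ y = fun _ => w ⬝ᵥ y := rfl
  have hcorner : (Matrix.of fun (_ _ : Unit) => ρ) *ᵥ (fun _ => t) = fun _ => ρ * t := by
    ext
    simp [mulVec, dotProduct]
  rw [bordered, fromBlocks_mulVec, sumElim_dotProduct_sumElim, Sum.elim_comp_inl,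
    Sum.elim_comp_inr, hcol, hrow, hcorner, dotProduct_add y, dotProduct_smul, frob_vecMulVec,
    dotProduct_comm y w]
  simp only [dotProduct, univ_unique, Pi.add_apply, sum_const, card_singleton, one_smul,
    smul_eq_mul]
  ring

theorem isHermitian_bordered_iff {ρ : ℝ} {w : Fin n → ℝ} {X : Matrix (Fin n) (Fin n) ℝ} :
    (bordered ρ w X).IsHermitian ↔ X.IsSymm := by
  rw [bordered, isHermitian_fromBlocks_iff, isHermitian_iff_isSymm, isHermitian_iff_isSymm]
  exact ⟨fun h => h.2.2.2, fun h => ⟨rfl, rfl, rfl, h⟩⟩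

theorem bordered_posSemidef_iff {ρ : ℝ} {w : Fin n → ℝ} {X : Matrix (Fin n) (Fin n) ℝ} :
    (bordered ρ w X).PosSemidef ↔ X.IsSymm ∧
      ∀ (t : ℝ) (y : Fin n → ℝ), 0 ≤ ρ * t ^ 2 + 2 * t * (w ⬝ᵥ y) + frob X (vecMulVec y y) := by
  rw [posSemidef_iff_dotProduct_mulVec, isHermitian_bordered_iff]
  refine and_congr_right fun _ => ⟨fun h t y => ?_, fun h z => ?_⟩
  · simpa only [star_trivial, dotProduct_bordered_mulVec] using h (Sum.elim (fun _ => t) y)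
  · rw [star_trivial, ← Sum.elim_comp_inl_inr z]
    exact (h (z (Sum.inl ())) (z ∘ Sum.inr)).trans_eq (dotProduct_bordered_mulVec ρ w X _ _).symm

theorem bordered_one_posSemidef_iff {x : Fin n → ℝ} {X : Matrix (Fin n) (Fin n) ℝ} :
    (bordered 1 x X).PosSemidef ↔ (X - vecMulVec x x).PosSemidef := by
  have hblock : bordered 1 x X
      = fromBlocks 1 (replicateRow Unit x) (replicateRow Unit x)ᴴ X := by
    rw [bordered]
    congr 1
  have hschur : vecMulVec x x
      = (replicateRow Unit x)ᴴ * (1 : Matrix Unit Unit ℝ)⁻¹ * replicateRow Unit x := by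
    ext i j
    simp [vecMulVec_apply, mul_apply]
  have : Invertible (1 : Matrix Unit Unit ℝ) := invertibleOne
  rw [hblock, hschur, PosDef.fromBlocks₁₁ _ _ PosDef.one]

theorem bordered_posSemidef_iff_forall_nonneg {M : Matrix (Fin n) (Fin n) ℝ} (hM : M.IsSymm)
    (v : Fin n → ℝ) (ρ : ℝ) : (bordered ρ ((1 / 2 : ℝ) • v) M).PosSemidef ↔
      ∀ x, 0 ≤ frob M (vecMulVec x x) + v ⬝ᵥ x + ρ := by
  have hform : ∀ (t : ℝ) (y : Fin n → ℝ), ρ * t ^ 2 + 2 * t * (((1 / 2 : ℝ) • v) ⬝ᵥ y)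
      + frob M (vecMulVec y y) = frob M (vecMulVec y y) + t * (v ⬝ᵥ y) + t ^ 2 * ρ := by
    intro t y
    rw [smul_dotProduct, smul_eq_mul]
    ring
  simp only [bordered_posSemidef_iff, hM, true_and, hform]
  refine ⟨fun h x => by simpa using h 1 x, fun h t y => ?_⟩
  have hclosed : IsClosed {t : ℝ | 0 ≤ frob M (vecMulVec y y) + t * (v ⬝ᵥ y) + t ^ 2 * ρ} :=
    isClosed_le continuous_const (by fun_prop)
  refine hclosed.closure_subset_iff.2 (fun t (ht : t ≠ 0) => ?_) (dense_compl_singleton (0 : ℝ) t)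
  have hscale : frob M (vecMulVec y y) + t * (v ⬝ᵥ y) + t ^ 2 * ρ
      = t ^ 2 * (frob M (vecMulVec (t⁻¹ • y) (t⁻¹ • y)) + v ⬝ᵥ (t⁻¹ • y) + ρ) := by
    simp only [smul_vecMulVec, vecMulVec_smul, frob_smul_right, dotProduct_smul, smul_eq_mul]
    field_simp
  exact (mul_nonneg (sq_nonneg t) (h _)).trans_eq hscale.symm

/-- The Shor relaxation of the set of all pairs `(x, xxᵀ)`: the domain that the semidefinite
constraint of `(SDP)` defines. -/
def shorSet (n : ℕ) : Set ((Fin n → ℝ) × Matrix (Fin n) (Fin n) ℝ) :=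
  {z | (bordered 1 z.1 z.2).PosSemidef}

theorem mk_vecMulVec_mem_shorSet (x : Fin n → ℝ) : (x, vecMulVec x x) ∈ shorSet n :=
  bordered_one_posSemidef_iff.2 (by simpa using PosSemidef.zero)

theorem frob_vecMulVec_le_of_mem_shorSet {S : Matrix (Fin n) (Fin n) ℝ} (hS : S.PosSemidef)
    {z : (Fin n → ℝ) × Matrix (Fin n) (Fin n) ℝ} (hz : z ∈ shorSet n) :
    frob S (vecMulVec z.1 z.1) ≤ frob S z.2 := by
  rw [← sub_nonneg, ← frob_sub_right]
  exact frob_nonneg hS (bordered_one_posSemidef_iff.1 hz)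

theorem sq_le_diag_of_mem_shorSet {z : (Fin n → ℝ) × Matrix (Fin n) (Fin n) ℝ}
    (hz : z ∈ shorSet n) (i : Fin n) : z.1 i ^ 2 ≤ z.2 i i := by
  have h := (bordered_one_posSemidef_iff.1 hz).diag_nonneg (i := i)
  rwa [Matrix.sub_apply, vecMulVec_apply, ← sq, sub_nonneg] at h

theorem convex_shorSet : Convex ℝ (shorSet n) := by
  intro z hz w hw a b ha hb hab
  have hcomb : bordered 1 (a • z + b • w).1 (a • z + b • w).2
      = a • bordered 1 z.1 z.2 + b • bordered 1 w.1 w.2 := by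
    simp only [bordered, fromBlocks_smul, fromBlocks_add]
    congr 1
    ext
    simp [hab]
  rw [shorSet, Set.mem_ofPred_eq, hcomb]
  exact (hz.smul ha).add (hw.smul hb)

theorem isClosed_shorSet : IsClosed (shorSet n) := by
  simp only [shorSet, bordered_posSemidef_iff, Set.ofPred_and, Set.ofPred_forall]
  refine (isClosed_eq (by fun_prop) (by fun_prop)).inter
    (isClosed_iInter fun t => isClosed_iInter fun y => isClosed_le continuous_const ?_)
  unfold frob
  fun_prop

theorem isCompact_shorSet_diag_le (κ : Fin n → ℝ) :
    IsCompact {z ∈ shorSet n | ∀ i, z.2 i i ≤ κ i} := by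
  have hbox : IsCompact ((Set.univ.pi fun i => Set.Icc (-(1 + κ i)) (1 + κ i)) ×ˢ
      (Set.univ.pi fun i => Set.univ.pi fun j => Set.Icc (-(κ i + κ j)) (κ i + κ j)) :
      Set ((Fin n → ℝ) × Matrix (Fin n) (Fin n) ℝ)) :=
    (isCompact_univ_pi fun _ => isCompact_Icc).prod
      (isCompact_univ_pi fun _ => isCompact_univ_pi fun _ => isCompact_Icc)
  have hclosed : IsClosed {z : (Fin n → ℝ) × Matrix (Fin n) (Fin n) ℝ | ∀ i, z.2 i i ≤ κ i} := by
    simp only [Set.ofPred_forall]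
    exact isClosed_iInter fun i => isClosed_le (by fun_prop) continuous_const
  refine hbox.of_isClosed_subset (isClosed_shorSet.inter hclosed) ?_
  rintro z ⟨hz, hκ⟩
  have hvec : ∀ i, 2 * |z.1 i| ≤ 1 + z.2 i i := fun i =>
    two_mul_abs_le_diag_add_diag hz (Sum.inl ()) (Sum.inr i)
  have hmat : ∀ i j, 2 * |z.2 i j| ≤ z.2 i i + z.2 j j :=
    two_mul_abs_le_diag_add_diag (hz.submatrix Sum.inr)
  refine ⟨fun i _ => abs_le.1 ?_, fun i _ j _ => abs_le.1 ?_⟩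
  · linarith [hvec i, hκ i, abs_nonneg (z.1 i)]
  · linarith [hmat i j, hκ i, hκ j, abs_nonneg (z.2 i j)]

/-- The coefficients `(M, v, a)` of a quadratic function `⟨M, xxᵀ⟩ + vᵀx + a`. -/
abbrev QuadraticCoeff (n : ℕ) := Matrix (Fin n) (Fin n) ℝ × (Fin n → ℝ) × ℝ

/-- The lift `⟨M, X⟩ + vᵀx + a` of the quadratic function `⟨M, xxᵀ⟩ + vᵀx + a` to an affine function
of `(x, X)`, linear in the coefficients. -/
def quadraticLift : QuadraticCoeff n →ₗ[ℝ] (Fin n → ℝ) × Matrix (Fin n) (Fin n) ℝ → ℝ where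
  toFun q z := frob q.1 z.2 + q.2.1 ⬝ᵥ z.1 + q.2.2
  map_add' p q := by
    ext z
    simp only [Prod.fst_add, Prod.snd_add, Pi.add_apply, frob_add, add_dotProduct]
    ring
  map_smul' a q := by
    ext z
    simp only [Prod.smul_fst, Prod.smul_snd, Pi.smul_apply, frob_smul, smul_dotProduct,
      smul_eq_mul, RingHom.id_apply]
    ring

theorem quadraticLift_apply (q : QuadraticCoeff n)
    (z : (Fin n → ℝ) × Matrix (Fin n) (Fin n) ℝ) :
    quadraticLift q z = frob q.1 z.2 + q.2.1 ⬝ᵥ z.1 + q.2.2 :=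
  rfl

theorem continuous_quadraticLift (q : QuadraticCoeff n) : Continuous (quadraticLift q) := by
  simp only [quadraticLift, LinearMap.coe_mk, AddHom.coe_mk, frob, dotProduct]
  fun_prop

theorem convexOn_quadraticLift (q : QuadraticCoeff n)
    {C : Set ((Fin n → ℝ) × Matrix (Fin n) (Fin n) ℝ)} (hC : Convex ℝ C) :
    ConvexOn ℝ C (quadraticLift q) := by
  refine ⟨hC, fun z _ w _ a b _ _ hab => le_of_eq ?_⟩
  simp only [quadraticLift_apply, Prod.fst_add, Prod.snd_add, Prod.smul_fst, Prod.smul_snd,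
    frob_add_right, frob_smul_right, dotProduct_add, dotProduct_smul, smul_eq_mul]
  linear_combination (-q.2.2) * hab

theorem bordered_posSemidef_iff_forall_quadraticLift_nonneg {M : Matrix (Fin n) (Fin n) ℝ}
    (hM : M.IsSymm) (v : Fin n → ℝ) (ρ : ℝ) : (bordered ρ ((1 / 2 : ℝ) • v) M).PosSemidef ↔
      ∀ z ∈ shorSet n, 0 ≤ quadraticLift (M, v, ρ) z := by
  refine ⟨fun h z hz => ?_, fun h => ?_⟩
  · have hquad := (bordered_posSemidef_iff_forall_nonneg hM v ρ).1 h z.1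
    have hfrob := frob_vecMulVec_le_of_mem_shorSet (h.submatrix Sum.inr) hz
    rw [quadraticLift_apply]
    exact hquad.trans (by gcongr; exact hfrob)
  · exact (bordered_posSemidef_iff_forall_nonneg hM v ρ).2 fun x => h _ (mk_vecMulVec_mem_shorSet x)

/-- The index set of the affine constraints of `(SDP)`: the quadratic constraints, the three
families of diagonal constraints, the McCormick constraints for `i < j` and the triangle constraints
for `i < j < k`. -/
abbrev ConstraintIndex (n m : ℕ) : Type :=
  Fin m ⊕ Fin n ⊕ Fin n ⊕ Fin n ⊕ ((i : Fin n) × Finset.Ioi i × Fin 4) ⊕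
    ((i : Fin n) × (j : Finset.Ioi i) × Finset.Ioi (j : Fin n) × Fin 12)

section Constraints

variable {m : ℕ} (P : QCQP n m)

/-- The coefficients of the constraint functions of `(SDP)`, all constraints being of the form
`≤ 0`. -/
def constraintCoeff : ConstraintIndex n m → QuadraticCoeff n
  | .inl r => (P.Q r, P.c r, -P.b r)
  | .inr (.inl i) => (Matrix.single i i 1, Pi.single i (-(P.u i + P.l i)), P.u i * P.l i)
  | .inr (.inr (.inl i)) => (-Matrix.single i i 1, Pi.single i (2 * P.u i), -P.u i ^ 2)
  | .inr (.inr (.inr (.inl i))) => (-Matrix.single i i 1, Pi.single i (2 * P.l i), -P.l i ^ 2)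
  | .inr (.inr (.inr (.inr (.inl ⟨i, j, t⟩)))) => (mcM i j t, P.mcV i j t, P.mcL i j t)
  | .inr (.inr (.inr (.inr (.inr ⟨i, j, k, t⟩)))) =>
    (P.triM i j k t, P.triV i j k t, P.triL i j k t)

/-- The vector of the constraint functions of `(SDP)`. -/
def constraints (z : (Fin n → ℝ) × Matrix (Fin n) (Fin n) ℝ) : ConstraintIndex n m → ℝ :=
  fun a => quadraticLift (P.constraintCoeff a) z

theorem constraintCoeff_isSymm (a : ConstraintIndex n m) : (P.constraintCoeff a).1.IsSymm := by
  rcases a with r | i | i | i | ⟨i, j, t⟩ | ⟨i, j, k, t⟩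
  · exact P.symm_Q r
  · exact transpose_single i i 1
  · exact IsSymm.neg (transpose_single i i 1)
  · exact IsSymm.neg (transpose_single i i 1)
  · fin_cases t
    · exact symE_isSymm i j
    · exact symE_isSymm i j
    · exact (symE_isSymm i j).neg
    · exact (symE_isSymm i j).neg
  · exact (((symE_isSymm _ _).smul _).add ((symE_isSymm _ _).smul _)).add
      ((symE_isSymm _ _).smul _)

theorem continuous_constraints : Continuous P.constraints :=
  continuous_pi fun _ => continuous_quadraticLift _

theorem convexOn_constraints {C : Set ((Fin n → ℝ) × Matrix (Fin n) (Fin n) ℝ)}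
    (hC : Convex ℝ C) : ConvexOn ℝ C P.constraints :=
  ⟨hC, fun _ hz _ hw _ _ ha hb hab a =>
    (convexOn_quadraticLift (P.constraintCoeff a) hC).2 hz hw ha hb hab⟩

theorem constraints_le_iff {z : (Fin n → ℝ) × Matrix (Fin n) (Fin n) ℝ} (hz : z.2.IsSymm) (a : ℝ) :
    (P.constraints z ≤ fun _ => a) ↔
      (∀ r, frob (P.Q r) z.2 + P.c r ⬝ᵥ z.1 - P.b r ≤ a) ∧
      (∀ i, z.2 i i - P.u i * z.1 i - P.l i * z.1 i + P.u i * P.l i ≤ a) ∧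
      (∀ i, -z.2 i i + 2 * P.u i * z.1 i - P.u i ^ 2 ≤ a) ∧
      (∀ i, -z.2 i i + 2 * P.l i * z.1 i - P.l i ^ 2 ≤ a) ∧
      (∀ i j, i < j → ∀ t, P.mc i j z.1 z.2 t ≤ a) ∧
      (∀ i j k, i < j → j < k → ∀ t, P.tri i j k z.1 z.2 t ≤ a) := by
  have hdiag : ∀ i, z.2 i i + -(P.u i + P.l i) * z.1 i + P.u i * P.l i
      = z.2 i i - P.u i * z.1 i - P.l i * z.1 i + P.u i * P.l i := fun i => by ring
  simp only [Pi.le_def, constraints, Sum.forall, Sigma.forall, Prod.forall, Subtype.forall,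
    Finset.mem_Ioi, constraintCoeff, quadraticLift_apply, ← P.mc_eq _ _ _ _ hz,
    ← P.tri_eq _ _ _ _ _ hz, frob_neg, frob_single, single_dotProduct, ← sub_eq_add_neg, hdiag]
  tauto

theorem mem_sdpFeasible_iff {z : (Fin n → ℝ) × Matrix (Fin n) (Fin n) ℝ} :
    z ∈ P.sdpFeasible ↔ z ∈ shorSet n ∧ P.constraints z ≤ 0 := by
  constructor
  · rintro ⟨hq, h₁, h₂, h₃, hsymm, hz, hmc, htri⟩
    exact ⟨hz, (P.constraints_le_iff hsymm 0).2
      ⟨fun r => sub_nonpos.2 (hq r), h₁, h₂, h₃, hmc, htri⟩⟩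
  · rintro ⟨hz, hle⟩
    have hsymm := (bordered_posSemidef_iff.1 hz).1
    obtain ⟨hq, h₁, h₂, h₃, hmc, htri⟩ := (P.constraints_le_iff hsymm 0).1 hle
    exact ⟨fun r => sub_nonpos.1 (hq r), h₁, h₂, h₃, hsymm, hz, hmc, htri⟩

theorem isCompact_shorSet_constraints_le_one :
    IsCompact {z ∈ shorSet n | P.constraints z ≤ 1} := by
  have hclosed : IsClosed {z | P.constraints z ≤ 1} :=
    isClosed_le P.continuous_constraints continuous_const
  refine (isCompact_shorSet_diag_le fun i => 2 + P.u i ^ 2 + P.l i ^ 2).of_isClosed_subset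
    (isClosed_shorSet.inter hclosed) ?_
  rintro z ⟨hz, hle⟩
  refine ⟨hz, fun i => ?_⟩
  have hsymm := (bordered_posSemidef_iff.1 hz).1
  have hdiag := ((P.constraints_le_iff hsymm 1).1 hle).2.1 i
  have hlinear := two_mul_le_add_sq (P.u i + P.l i) (z.1 i)
  linarith [sq_le_diag_of_mem_shorSet hz i]

namespace DualVars

/-- The dual variables of `(SDP)` other than `ρ`, as a vector of Lagrange multipliers indexed by the
affine constraints. -/
def multiplier (D : DualVars n m) : ConstraintIndex n m → ℝ
  | .inl r => D.α r
  | .inr (.inl i) => D.φ₁ i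
  | .inr (.inr (.inl i)) => D.φ₂ i
  | .inr (.inr (.inr (.inl i))) => D.φ₃ i
  | .inr (.inr (.inr (.inr (.inl ⟨i, j, t⟩)))) => D.φ i j t
  | .inr (.inr (.inr (.inr (.inr ⟨i, j, k, t⟩)))) => D.δ i j k t

/-- The dual variables with given multipliers and given `ρ`, extended by `0` to the indices that are
not increasing. -/
def ofMultiplier (c : ConstraintIndex n m → ℝ) (ρ : ℝ) : DualVars n m where
  α r := c (.inl r)
  φ₁ i := c (.inr (.inl i))
  φ₂ i := c (.inr (.inr (.inl i)))
  φ₃ i := c (.inr (.inr (.inr (.inl i))))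
  φ i j t := if hij : i < j then
    c (.inr (.inr (.inr (.inr (.inl ⟨i, ⟨j, Finset.mem_Ioi.2 hij⟩, t⟩))))) else 0
  δ i j k t := if h : i < j ∧ j < k then
    c (.inr (.inr (.inr (.inr (.inr
      ⟨i, ⟨j, Finset.mem_Ioi.2 h.1⟩, ⟨k, Finset.mem_Ioi.2 h.2⟩, t⟩))))) else 0
  ρ := ρ

theorem multiplier_ofMultiplier (c : ConstraintIndex n m → ℝ) (ρ : ℝ) :
    (ofMultiplier c ρ).multiplier = c := by
  ext (r | i | i | i | ⟨i, ⟨j, hj⟩, t⟩ | ⟨i, ⟨j, hj⟩, ⟨k, hk⟩, t⟩)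
  · rfl
  · rfl
  · rfl
  · rfl
  · exact dif_pos (Finset.mem_Ioi.1 hj)
  · exact dif_pos ⟨Finset.mem_Ioi.1 hj, Finset.mem_Ioi.1 hk⟩

theorem multiplier_nonneg_iff {D : DualVars n m} : 0 ≤ D.multiplier ↔
    (∀ r, 0 ≤ D.α r) ∧ (∀ i j, i < j → ∀ t, 0 ≤ D.φ i j t) ∧
    (∀ i, 0 ≤ D.φ₁ i) ∧ (∀ i, 0 ≤ D.φ₂ i) ∧ (∀ i, 0 ≤ D.φ₃ i) ∧
    (∀ i j k, i < j → j < k → ∀ t, 0 ≤ D.δ i j k t) := by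
  simp only [Pi.le_def, Pi.zero_apply, Sum.forall, Sigma.forall, Prod.forall, Subtype.forall,
    Finset.mem_Ioi, multiplier]
  tauto

end DualVars

theorem objective_add_sum_multiplier_smul (D : DualVars n m) :
    (P.Q₀, P.c₀, 0) + ∑ a, D.multiplier a • P.constraintCoeff a
      = (P.dualS D, P.dualD D, P.dualObj D + D.ρ) := by
  have hdiag : diagonal (D.φ₁ - D.φ₂ - D.φ₃) = diagonal D.φ₁ - diagonal D.φ₂ - diagonal D.φ₃ := by
    simp only [diagonal_sub, Pi.sub_def]
  have hvec : ∀ φ w : Fin n → ℝ, ∑ i, Pi.single i (φ i * w i) = φ * w := fun φ w =>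
    Finset.univ_sum_single (φ * w)
  have hvec₁ : ∑ i, Pi.single i (D.φ₁ i * -(P.u i + P.l i)) = -(D.φ₁ * (P.u + P.l)) := by
    rw [← mul_neg]
    exact hvec D.φ₁ (-(P.u + P.l))
  have hvec₂ : ∀ φ w : Fin n → ℝ,
      ∑ i, Pi.single i (φ i * (2 * w i)) = (2 : ℝ) • (φ * w) := fun φ w => by
    rw [← mul_smul_comm]
    exact hvec φ ((2 : ℝ) • w)
  simp only [dualS, dualD, dualObj, Phi, Delta, ← Finset.sum_coe_sort (Finset.Ioi _),
    Fintype.sum_sum_type, Fintype.sum_sigma, Fintype.sum_prod_type, DualVars.multiplier,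
    constraintCoeff, Prod.smul_mk]
  refine Prod.ext ?_ (Prod.ext ?_ ?_)
  · simp only [Prod.fst_add, Prod.fst_sum, smul_neg, Finset.sum_neg_distrib, smul_single,
      smul_eq_mul, mul_one, sum_single_eq_diagonal, hdiag]
    abel
  · simp only [Prod.fst_add, Prod.snd_add, Prod.fst_sum, Prod.snd_sum, ← Pi.single_smul,
      smul_eq_mul, hvec₁, hvec₂]
    abel
  · simp only [Prod.snd_add, Prod.snd_sum, smul_eq_mul, mul_neg, neg_mul,
      Finset.sum_neg_distrib, mul_comm (D.φ₁ _), mul_comm (D.φ₂ _), mul_comm (D.φ₃ _)]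
    ring

theorem dualS_isSymm (D : DualVars n m) : (P.dualS D).IsSymm := by
  have hsum : P.dualS D = P.Q₀ + ∑ a, D.multiplier a • (P.constraintCoeff a).1 := by
    simpa only [Prod.fst_add, Prod.fst_sum, Prod.smul_fst] using
      congrArg Prod.fst (P.objective_add_sum_multiplier_smul D).symm
  rw [hsum]
  refine P.symm_Q₀.add ?_
  rw [IsSymm, transpose_sum]
  exact Finset.sum_congr rfl fun a _ => (P.constraintCoeff_isSymm a).smul (D.multiplier a)

theorem objective_add_multiplier_dotProduct_constraints (D : DualVars n m)
    (z : (Fin n → ℝ) × Matrix (Fin n) (Fin n) ℝ) :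
    quadraticLift (P.Q₀, P.c₀, 0) z + D.multiplier ⬝ᵥ P.constraints z
      = quadraticLift (P.dualS D, P.dualD D, P.dualObj D + D.ρ) z := by
  rw [← P.objective_add_sum_multiplier_smul D, map_add, map_sum, Pi.add_apply, Finset.sum_apply]
  simp only [map_smul, Pi.smul_apply, smul_eq_mul]
  rfl

theorem dualFeasible_iff {D : DualVars n m} : P.DualFeasible D ↔ 0 ≤ D.multiplier ∧
    ∀ z ∈ shorSet n,
      P.dualObj D ≤ quadraticLift (P.Q₀, P.c₀, 0) z + D.multiplier ⬝ᵥ P.constraints z := by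
  have hsub : ∀ z, quadraticLift (P.Q₀, P.c₀, 0) z + D.multiplier ⬝ᵥ P.constraints z - P.dualObj D
      = quadraticLift (P.dualS D, P.dualD D, D.ρ) z := fun z => by
    rw [objective_add_multiplier_dotProduct_constraints, quadraticLift_apply, quadraticLift_apply]
    ring
  simp only [DualFeasible, DualVars.multiplier_nonneg_iff,
    bordered_posSemidef_iff_forall_quadraticLift_nonneg (P.dualS_isSymm D), ← hsub, sub_nonneg,
    and_assoc]

theorem exists_multiplier_eq_and_dualObj_eq (c : ConstraintIndex n m → ℝ) (v : ℝ) :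
    ∃ D : DualVars n m, D.multiplier = c ∧ P.dualObj D = v := by
  refine ⟨.ofMultiplier c (P.dualObj (.ofMultiplier c 0) - v), DualVars.multiplier_ofMultiplier c _,
    ?_⟩
  simp only [dualObj, DualVars.ofMultiplier]
  ring

theorem sdpValue_le_dualObj {D : DualVars n m} (hD : P.IsDualOptimal D) :
    P.sdpValue ≤ P.dualObj D := by
  by_contra! hlt
  obtain ⟨v, hDv, hv⟩ := EReal.lt_iff_exists_real_btwn.1 hlt
  have hv' : ∀ z ∈ shorSet n, P.constraints z ≤ 0 → v < quadraticLift (P.Q₀, P.c₀, 0) z :=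
    fun z hz hle => by
      rw [quadraticLift_apply, add_zero, ← EReal.coe_lt_coe_iff]
      exact hv.trans_le (iInf₂_le z (P.mem_sdpFeasible_iff.2 ⟨hz, hle⟩))
  obtain ⟨hmul, hobj⟩ := P.dualFeasible_iff.1 hD.1
  obtain ⟨c, hc, hle⟩ := exists_lagrange_multipliers (convexOn_quadraticLift _ convex_shorSet)
    (P.convexOn_constraints convex_shorSet) (continuous_quadraticLift _).continuousOn
    P.continuous_constraints.continuousOn P.isCompact_shorSet_constraints_le_one hmul hobj hv'
  obtain ⟨D', hD'c, hD'v⟩ := P.exists_multiplier_eq_and_dualObj_eq c v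
  have hfeas : P.DualFeasible D' := P.dualFeasible_iff.2 (by rw [hD'c, hD'v]; exact ⟨hc, hle⟩)
  exact (EReal.coe_lt_coe_iff.1 hDv).not_ge (hD'v ▸ hD.2 D' hfeas)

theorem forall_mc_diag_nonpos_iff (i : Fin n) (x : Fin n → ℝ) (Y : Matrix (Fin n) (Fin n) ℝ) :
    (∀ t, P.mc i i x Y t ≤ 0) ↔
      Y i i - P.u i * x i - P.l i * x i + P.u i * P.l i ≤ 0 ∧
      -Y i i + 2 * P.u i * x i - P.u i ^ 2 ≤ 0 ∧
      -Y i i + 2 * P.l i * x i - P.l i ^ 2 ≤ 0 := by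
  simp only [mc, Fin.forall_fin_succ, cons_val_zero, cons_val_succ, IsEmpty.forall_iff, and_true]
  constructor
  · rintro ⟨h₁, -, h₃, h₄⟩
    exact ⟨h₁, by linarith, by linarith⟩
  · rintro ⟨h₁, h₂, h₃⟩
    exact ⟨h₁, by linarith, by linarith, by linarith⟩

theorem constraints_nonpos_of_mem_starFeasible {z : (Fin n → ℝ) × Matrix (Fin n) (Fin n) ℝ}
    (hz : z ∈ P.starFeasible) : P.constraints z ≤ 0 := by
  obtain ⟨hq, hmc, htri, hsymm⟩ := hz
  have hdiag := fun i => (P.forall_mc_diag_nonpos_iff i z.1 z.2).1 (hmc i i le_rfl)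
  exact (P.constraints_le_iff (isSymm_of_forall_lt hsymm) 0).2
    ⟨fun r => sub_nonpos.2 (hq r), fun i => (hdiag i).1, fun i => (hdiag i).2.1,
      fun i => (hdiag i).2.2, fun i j hij => hmc i j hij.le, htri⟩

theorem starValue_eq_optValue (D : DualVars n m) : P.starValue D = optValue P.starFeasible fun z =>
    frob (P.dualS D) (vecMulVec z.1 z.1) + P.c₀ ⬝ᵥ z.1 + frob (P.Q₀ - P.dualS D) z.2 := by
  have hsub : -(∑ r, D.α r • P.Q r) - Phi D - P.Delta D = P.Q₀ - P.dualS D := by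
    rw [dualS]
    abel
  rw [starValue, hsub, dualS]

theorem dualObj_le_starValue {D : DualVars n m} (hD : P.DualFeasible D) :
    (P.dualObj D : EReal) ≤ P.starValue D := by
  rw [starValue_eq_optValue]
  refine le_iInf₂ fun z hz => EReal.coe_le_coe_iff.2 ?_
  have hmul : D.multiplier ⬝ᵥ P.constraints z ≤ 0 :=
    Finset.sum_nonpos fun a _ => mul_nonpos_of_nonneg_of_nonpos ((P.dualFeasible_iff.1 hD).1 a)
      (P.constraints_nonpos_of_mem_starFeasible hz a)
  have hquad : 0 ≤ frob (P.dualS D) (vecMulVec z.1 z.1) + P.dualD D ⬝ᵥ z.1 + D.ρ :=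
    (bordered_posSemidef_iff_forall_nonneg (P.dualS_isSymm D) _ _).1 hD.2.2.2.2.2.2 z.1
  have hlagrangian := P.objective_add_multiplier_dotProduct_constraints D z
  simp only [quadraticLift_apply] at hlagrangian
  linarith [frob_sub_left P.Q₀ (P.dualS D) z.2]

theorem starValue_le_relaxValue (D : DualVars n m) :
    P.starValue D ≤ P.relaxValue (P.dualS D) fun _ => 0 := by
  rw [starValue_eq_optValue]
  refine biInf_mono fun z ⟨_, hq, hmc, htri, hsymm⟩ => ⟨fun r => ?_, hmc, htri, hsymm⟩
  have hr := hq r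
  rwa [sub_zero, ← sub_self (0 : Matrix (Fin n) (Fin n) ℝ), frob_sub_left, sub_self, zero_add,
    add_comm] at hr

theorem mem_Icc_of_mem_sdpFeasible (hlu : P.l ≤ P.u)
    {z : (Fin n → ℝ) × Matrix (Fin n) (Fin n) ℝ} (hz : z ∈ P.sdpFeasible) :
    z.1 ∈ Set.Icc P.l P.u := by
  obtain ⟨-, hdiag, -, -, -, hshor, -⟩ := hz
  have hmul : ∀ i, (z.1 i - P.l i) * (z.1 i - P.u i) ≤ 0 := fun i => by
    linarith [hdiag i, sq_le_diag_of_mem_shorSet hshor i]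
  constructor <;> intro i <;> nlinarith [hlu i, hmul i]

theorem sdpFeasible_subset_relaxFeasible (hlu : P.l ≤ P.u) {S : Fin m → Matrix (Fin n) (Fin n) ℝ}
    (hS : ∀ r, (S r).PosSemidef) : P.sdpFeasible ⊆ P.relaxFeasible S := by
  intro z hz
  obtain ⟨hl, hu⟩ := P.mem_Icc_of_mem_sdpFeasible hlu hz
  obtain ⟨hq, h₁, h₂, h₃, hsymm, hshor, hmc, htri⟩ := hz
  refine ⟨fun i => ⟨hl i, hu i⟩, fun r => ?_, fun i j hij => ?_, htri,
    fun i j _ => hsymm.apply i j⟩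
  · rw [frob_sub_left]
    linarith [hq r, frob_vecMulVec_le_of_mem_shorSet (hS r) hshor]
  · rcases hij.lt_or_eq with hij | rfl
    · exact hmc i j hij
    · exact (P.forall_mc_diag_nonpos_iff i z.1 z.2).2 ⟨h₁ i, h₂ i, h₃ i⟩

theorem relaxValue_le_sdpValue (hlu : P.l ≤ P.u) {S₀ : Matrix (Fin n) (Fin n) ℝ}
    {S : Fin m → Matrix (Fin n) (Fin n) ℝ} (hS : OptFeasible S₀ S) :
    P.relaxValue S₀ S ≤ P.sdpValue := by
  refine iInf₂_mono' fun z hz => ⟨z, P.sdpFeasible_subset_relaxFeasible hlu hS.2 hz, ?_⟩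
  obtain ⟨-, -, -, -, -, hshor, -⟩ := hz
  rw [EReal.coe_le_coe_iff]
  linarith [frob_sub_left P.Q₀ S₀ z.2, frob_vecMulVec_le_of_mem_shorSet hS.1 hshor]

end Constraints

end QCQP

end

theorem corollary1_general {n m : ℕ} (P : QCQP n m) (hlu : P.l ≤ P.u)
    (D : QCQP.DualVars n m) (hD : P.IsDualOptimal D) :
    P.IsOptSolution (P.dualS D) (fun _ => 0) ∧
    P.optOptValue = P.relaxValue (P.dualS D) (fun _ => 0) ∧
    P.relaxValue (P.dualS D) (fun _ => 0) = P.sdpValue ∧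
    P.starValue D = P.sdpValue := by
  have hfeas : QCQP.OptFeasible (P.dualS D) fun _ : Fin m => 0 :=
    ⟨hD.1.2.2.2.2.2.2.submatrix Sum.inr, fun _ => PosSemidef.zero⟩
  have hsdp_star : P.sdpValue ≤ P.starValue D :=
    (P.sdpValue_le_dualObj hD).trans (P.dualObj_le_starValue hD.1)
  have hstar_relax := P.starValue_le_relaxValue D
  have hrelax_sdp := P.relaxValue_le_sdpValue hlu hfeas
  have hmax : ∀ S₀ S, QCQP.OptFeasible S₀ S →
      P.relaxValue S₀ S ≤ P.relaxValue (P.dualS D) fun _ => 0 := fun S₀ S hS =>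
    (P.relaxValue_le_sdpValue hlu hS).trans (hsdp_star.trans hstar_relax)
  exact ⟨⟨hfeas, hmax⟩,
    le_antisymm (iSup₂_le fun S₀ S => iSup_le (hmax S₀ S))
      (le_iSup₂_of_le (P.dualS D) (fun _ => 0) (le_iSup_of_le hfeas le_rfl)),
    le_antisymm hrelax_sdp (hsdp_star.trans hstar_relax),
    le_antisymm (hstar_relax.trans hrelax_sdp) hsdp_star⟩

theorem corollary1 {n m : ℕ} (P : QCQP n m) (hl : ∀ i, 0 ≤ P.l i)
    (hP : P.feasibleSet.Nonempty)
    (D : QCQP.DualVars n m) (hD : P.IsDualOptimal D) :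
    P.IsOptSolution (P.Q₀ + ∑ r, D.α r • P.Q r + QCQP.Phi D + P.Delta D) (fun _ => 0) ∧
    P.optOptValue =
      P.relaxValue (P.Q₀ + ∑ r, D.α r • P.Q r + QCQP.Phi D + P.Delta D) (fun _ => 0) ∧
    P.relaxValue (P.Q₀ + ∑ r, D.α r • P.Q r + QCQP.Phi D + P.Delta D) (fun _ => 0) =
      P.sdpValue ∧
    P.starValue D = P.sdpValue := by
  obtain ⟨x, hx⟩ := hP
  exact corollary1_general P (fun i => (hx.2 i).1.trans (hx.2 i).2) D hD
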